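/- Let $K$ be an algebraically closed field of characteristic $0$, and let $\alpha,\beta,\gamma\in K$ satisfy $\alpha+\beta=1$, $\gamma\neq 0$ and $\eta:=-\beta\notin\{0,1\}$. Let $A_\eta=A(\alpha,\beta,\gamma)$ be the down-up algebra, i.e. the unital associative $K$-algebra with generators $d,u$ and defining relations $$d^2u=\alpha\,dud+\beta\,ud^2+\gamma\,d,\qquad du^2=\alpha\,udu+\beta\,u^2d+\gamma\,u.$$ For $\lambda\in K$ put $\lambda_{-1}=0$, $\lambda_0=\lambda$ and $\lambda_n=\alpha\lambda_{n-1}+\beta\lambda_{n-2}+\gamma$ for $n\geq 1$. The Verma module $V(\lambda)$ is the $A_\eta$-module with $K$-basis $v_0,v_1,v_2,\dots$ and action $d\,v_0=0$, $d\,v_n=\lambda_{n-1}v_{n-1}$ for $n\geq 1$, and $u\,v_n=v_{n+1}$ for $n\geq 0$. For integers $m,n\geq 1$ let $$X_{m,n}=\{\zeta\in K\setminus\{0\} : \zeta^m\neq 1,\ \zeta^n\neq 1,\ n(\zeta^m-1)=m(\zeta^n-1)\}.$$ Then the following are equivalent: (i) every finite-dimensional $A_\eta$-module is semisimple; (ii)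 for every $\lambda\in K$ the Verma module $V(\lambda)$ has composition length at most $2$; (iii) $\eta\notin X_{m,n}$ for all integers $m,n\geq 1$ with $m\neq n$. -/

import Mathlib

universe u

/-- The two generators of a down-up algebra. -/
inductive DownUpGen : Type
  | d
  | u

namespace DownUp

variable {K : Type u} [Field K]

/-- The generator `d` in the free algebra. -/
abbrev fd : FreeAlgebra K DownUpGen := FreeAlgebra.ι K DownUpGen.d

/-- The generator `u` in the free algebra. -/
abbrev fu : FreeAlgebra K DownUpGen := FreeAlgebra.ι K DownUpGen.u

/-- The defining relations
`d²u = α dud + β ud² + γ d` and `du² = α udu + β u²d + γ u`. -/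
inductive Rel (α β γ : K) : FreeAlgebra K DownUpGen → FreeAlgebra K DownUpGen → Prop
  | r1 : Rel α β γ (fd * fd * fu)
      (α • (fd * fu * fd) + β • (fu * fd * fd) + γ • fd)
  | r2 : Rel α β γ (fd * fu * fu)
      (α • (fu * fd * fu) + β • (fu * fu * fd) + γ • fu)

end DownUp

/-- The down-up algebra `A(α, β, γ)` over `K`: the unital associative `K`-algebra presented by
the generators `d, u` and the two relations `DownUp.Rel`. -/
def DownUpAlgebra {K : Type u} [Field K] (α β γ : K) : Type u :=
  RingQuot (DownUp.Rel α β γ)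

noncomputable section

namespace DownUp

variable {K : Type u} [Field K]

instance (α β γ : K) : Ring (DownUpAlgebra α β γ) :=
  inferInstanceAs (Ring (RingQuot (Rel α β γ)))

instance (α β γ : K) : Algebra K (DownUpAlgebra α β γ) :=
  inferInstanceAs (Algebra K (RingQuot (Rel α β γ)))

/-- The sequence of the `λ_n`, shifted by one: `vermaSeq α β γ lam n = λ_{n-1}`, where
`λ_{-1} = 0`, `λ_0 = lam` and `λ_n = α λ_{n-1} + β λ_{n-2} + γ` for `n ≥ 1`. -/
def vermaSeq (α β γ lam : K) : ℕ → K
  | 0 => 0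
  | 1 => lam
  | n + 2 => α * vermaSeq α β γ lam (n + 1) + β * vermaSeq α β γ lam n + γ

/-- The action of `d` on the space with basis `v_0, v_1, …`: `d v_0 = 0` and
`d v_n = λ_{n-1} v_{n-1}` for `n ≥ 1` (the coefficient `vermaSeq α β γ lam 0` is zero). -/
def vermaD (α β γ lam : K) : Module.End K (ℕ →₀ K) :=
  Finsupp.lsum K fun n => LinearMap.toSpanSingleton K (ℕ →₀ K)
    (Finsupp.single (n - 1) (vermaSeq α β γ lam n))

/-- The action of `u` on the space with basis `v_0, v_1, …`: `u v_n = v_{n+1}`. -/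
def vermaU (K : Type u) [Field K] : Module.End K (ℕ →₀ K) :=
  Finsupp.lsum K fun n => LinearMap.toSpanSingleton K (ℕ →₀ K) (Finsupp.single (n + 1) 1)

/-- The action of the generators on the Verma module. -/
def vermaGen (α β γ lam : K) : DownUpGen → Module.End K (ℕ →₀ K)
  | DownUpGen.d => vermaD α β γ lam
  | DownUpGen.u => vermaU K

theorem vermaD_single (α β γ lam : K) (n : ℕ) (c : K) :
    vermaD α β γ lam (Finsupp.single n c) =
      Finsupp.single (n - 1) (c * vermaSeq α β γ lam n) := by
  simp [vermaD, -Finsupp.single_mul]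

theorem vermaU_single (n : ℕ) (c : K) :
    vermaU K (Finsupp.single n c) = Finsupp.single (n + 1) c := by
  simp [vermaU]

theorem vermaGen_rel (α β γ lam : K) ⦃x y : FreeAlgebra K DownUpGen⦄ (h : Rel α β γ x y) :
    FreeAlgebra.lift K (vermaGen α β γ lam) x = FreeAlgebra.lift K (vermaGen α β γ lam) y := by
  cases h with
  | r1 =>
    refine Finsupp.lhom_ext fun n c => ?_
    rcases n with _ | _ | n <;>
      simp [vermaGen, vermaD_single, vermaU_single, vermaSeq, ← Finsupp.single_add,
        -Finsupp.single_mul]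
    all_goals congr 1; ring
  | r2 =>
    refine Finsupp.lhom_ext fun n c => ?_
    rcases n with _ | n <;>
      simp [vermaGen, vermaD_single, vermaU_single, vermaSeq, ← Finsupp.single_add,
        -Finsupp.single_mul]
    all_goals congr 1; ring

/-- The representation of `A(α, β, γ)` on the Verma module of highest weight `lam`. -/
def vermaRep (α β γ lam : K) : DownUpAlgebra α β γ →ₐ[K] Module.End K (ℕ →₀ K) :=
  RingQuot.liftAlgHom K ⟨FreeAlgebra.lift K (vermaGen α β γ lam), vermaGen_rel α β γ lam⟩

end DownUp

/-- The Verma module `V(lam)` of `A(α, β, γ)`, with basis `v_0, v_1, …` where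
`v_n = Finsupp.single n 1`. -/
@[nolint unusedArguments]
def DownUpVerma {K : Type u} [Field K] (_α _β _γ _lam : K) : Type u := ℕ →₀ K

namespace DownUp

variable {K : Type u} [Field K]

instance (α β γ lam : K) : AddCommGroup (DownUpVerma α β γ lam) :=
  inferInstanceAs (AddCommGroup (ℕ →₀ K))

instance (α β γ lam : K) : Module K (DownUpVerma α β γ lam) :=
  inferInstanceAs (Module K (ℕ →₀ K))

instance (α β γ lam : K) : Module (DownUpAlgebra α β γ) (DownUpVerma α β γ lam) :=
  Module.compHom (ℕ →₀ K) (vermaRep α β γ lam).toRingHom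

/-- `X_{m,n} = {η ∈ K^* | η^m ≠ 1 ≠ η^n and n(η^m - 1) = m(η^n - 1)}`. -/
def X (K : Type u) [Field K] (m n : ℕ) : Set K :=
  {η | η ≠ 0 ∧ η ^ m ≠ 1 ∧ η ^ n ≠ 1 ∧ (n : K) * (η ^ m - 1) = (m : K) * (η ^ n - 1)}

end DownUp

end

/-! Each condition is compared with `AtMostOneZero`: no sequence λ_{-1} = 0, λ_0, λ_1, … vanishes at
two later places. The recurrence has characteristic roots 1 and η, and its explicit solution turns
two zeros into membership of η in some X_{m,n}. A zero at index n of `vermaSeq` makes v_n, v_{n+1},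
… span a submodule of V(λ). Two zeros 1 ≤ m < n give a chain of length three, and the quotient by
the smaller tail is finite-dimensional and not semisimple, because the class of v_0 generates it.
With at most one zero, V(λ) is simple or has a simple tail with simple quotient. For semisimplicity
of a finite-dimensional M, a trace argument makes d and u nilpotent (`isNilpotent_generators`). On
ker d the operator d^k u^k is a squarefree polynomial in du, so du is diagonalizable there; each
eigenvector generates a proper quotient of a Verma module, hence a simple module. Thus ker d lies in
the socle N (`AtMostOneZero.ker_le_socle`). If N ≠ M, lift a highest weight vector of M/N to v. By
`exists_gd_smul_eq`, dv = dy for some y in N, since u^k d^k multiplies dv by nonzero terms λ_{-i}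
modulo dN. Then v - y is in ker d, so v is in N, a contradiction. -/

/-! ### Nilpotency from traces -/

/-- An endomorphism of a finite-dimensional space in characteristic zero is nilpotent if all its
positive powers have trace zero. -/
theorem LinearMap.isNilpotent_of_forall_trace_pow_eq_zero {K V : Type*} [Field K] [CharZero K]
    [AddCommGroup V] [Module K V] [FiniteDimensional K V] (f : Module.End K V)
    (h : ∀ k : ℕ, LinearMap.trace K V (f ^ (k + 1)) = 0) : IsNilpotent f := by
  open Polynomial in
  have hp : minpoly K f ≠ 0 := minpoly.ne_zero (Algebra.IsIntegral.isIntegral f)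
  obtain ⟨q, hq, hdvd⟩ := exists_eq_pow_rootMultiplicity_mul_and_not_dvd (minpoly K f) hp 0
  rw [C_0, sub_zero] at hq hdvd
  set k := (minpoly K f).rootMultiplicity 0
  -- The exponent k + 1 instead of k keeps every power of `f` below positive, even when k = 0.
  have hcop : IsCoprime (X ^ (k + 1) : K[X]) q :=
    ((prime_X.irreducible).coprime_iff_not_dvd.2 hdvd).pow_left
  obtain ⟨a, b, hab⟩ := hcop
  have hzero : f ^ (k + 1) * aeval f q = 0 := by
    have := minpoly.aeval K f
    rw [hq, map_mul, aeval_X_pow] at this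
    rw [pow_succ', mul_assoc, this, mul_zero]
  have hone : aeval f a * f ^ (k + 1) + aeval f b * aeval f q = 1 := by
    simpa using congrArg (aeval f) hab
  have hcomm : ∀ r : K[X], aeval f r * f ^ (k + 1) = f ^ (k + 1) * aeval f r := fun r => by
    have := congrArg (aeval f) (mul_comm r (X ^ (k + 1)))
    simpa using this
  -- This is the Fitting projection onto the part where `f` is invertible. It is a combination of
  -- positive powers of `f`, so its trace is zero, and in characteristic zero an idempotent of trace
  -- zero vanishes.
  have hidem : IsIdempotentElem (aeval f a * f ^ (k + 1)) := by
    have h1 : (aeval f a * f ^ (k + 1)) * (aeval f b * aeval f q) = 0 := by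
      rw [mul_assoc, ← mul_assoc (f ^ (k + 1)), ← hcomm b, mul_assoc, hzero, mul_zero, mul_zero]
    have h2 := congrArg (fun y => (aeval f a * f ^ (k + 1)) * y) hone
    simp only [mul_add, h1, add_zero, mul_one] at h2
    exact h2
  have htr : ∀ r : K[X], LinearMap.trace K V (aeval f r * f ^ (k + 1)) = 0 := by
    intro r
    induction r using Polynomial.induction_on' with
    | add p q hp hq => simp [add_mul, hp, hq]
    | monomial n c =>
      have h1 := h (n + k)
      rw [aeval_monomial, mul_assoc, ← pow_add, ← add_assoc] at *
      rw [Algebra.algebraMap_eq_smul_one, smul_mul_assoc, one_mul, map_smul, h1, smul_zero]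
  have he := (LinearMap.IsIdempotentElem.trace_eq_zero_iff hidem).1 (htr a)
  refine ⟨k + 1, ?_⟩
  have h3 := congrArg (fun y => f ^ (k + 1) * y) hone
  simp only [he, zero_add, mul_one] at h3
  rw [← h3, ← mul_assoc, ← hcomm b, mul_assoc, hzero, mul_zero]

/-- If `a e = e b`, `w e = ζ e w` with `ζ ≠ 1`, and `a - b - w` is a nonzero scalar, then `e` is
nilpotent. -/
theorem LinearMap.isNilpotent_of_intertwines {K V : Type*} [Field K] [CharZero K]
    [AddCommGroup V] [Module K V] [FiniteDimensional K V] {e a b w : Module.End K V} {ζ c : K}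
    (hab : a * e = e * b) (hw : w * e = ζ • (e * w)) (hζ : ζ ≠ 1) (hc : c ≠ 0)
    (h : a - b = w + c • 1) : IsNilpotent e := by
  refine LinearMap.isNilpotent_of_forall_trace_pow_eq_zero e fun k => ?_
  -- Cyclicity of the trace makes the `a` and `b` terms cancel and gives tr(w e^(k+1)) = ζ tr(w
  -- e^(k+1)), so this trace is zero. What remains is c tr(e^(k+1)) = 0.
  have h1 : LinearMap.trace K V (a * e ^ (k + 1)) = LinearMap.trace K V (b * e ^ (k + 1)) := by
    rw [pow_succ', ← mul_assoc, hab, mul_assoc, LinearMap.trace_mul_comm, mul_assoc,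
      ← pow_succ, ← pow_succ']
  have h2 : LinearMap.trace K V (w * e ^ (k + 1)) =
      ζ * LinearMap.trace K V (w * e ^ (k + 1)) := by
    conv_lhs => rw [pow_succ', ← mul_assoc, hw, smul_mul_assoc, map_smul, mul_assoc,
      LinearMap.trace_mul_comm, mul_assoc, ← pow_succ]
    rfl
  have h3 : LinearMap.trace K V (w * e ^ (k + 1)) = 0 := by
    have : (1 - ζ) * LinearMap.trace K V (w * e ^ (k + 1)) = 0 := by
      rw [sub_mul, one_mul, ← h2, sub_self]
    exact (mul_eq_zero.1 this).resolve_left (sub_ne_zero.2 hζ.symm)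
  have h4 := congrArg (fun y => LinearMap.trace K V (y * e ^ (k + 1))) h
  simp only [sub_mul, add_mul, map_sub, map_add, h1, h3, sub_self, zero_add, smul_mul_assoc,
    one_mul, map_smul, smul_eq_mul] at h4
  exact (mul_eq_zero.1 h4.symm).resolve_left hc

/-! ### Zeros of the weight sequences -/

namespace DownUp

variable {K : Type u} [Field K]

/-- No sequence `λ_{-1} = 0, λ_0, λ_1, …` has more than one zero besides `λ_{-1}`. -/
def AtMostOneZero (α β γ : K) : Prop :=
  ∀ lam : K, ∀ m n : ℕ, 1 ≤ m → 1 ≤ n → vermaSeq α β γ lam m = 0 → vermaSeq α β γ lam n = 0 →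
    m = n

/-- The characteristic roots are 1 and η. The constant term γ resonates with the root 1, whence the
summand linear in n. The factor (1 - η)² clears denominators. -/
theorem vermaSeq_closed_form (η γ lam : K) (n : ℕ) :
    (1 - η) ^ 2 * vermaSeq (1 + η) (-η) γ lam n =
      n * γ * (1 - η) + ((1 - η) * lam - γ) * (1 - η ^ n) := by
  induction n using Nat.twoStepInduction with
  | zero => simp [vermaSeq]
  | one => simp [vermaSeq]; ring
  | more n h1 h2 =>
    rw [vermaSeq]
    push_cast at h2 ⊢
    linear_combination (1 + η) * h2 - η * h1

theorem vermaSeq_eq_zero_iff {η : K} (hη1 : η ≠ 1) (γ lam : K) (n : ℕ) :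
    vermaSeq (1 + η) (-η) γ lam n = 0 ↔
      n * γ * (1 - η) + ((1 - η) * lam - γ) * (1 - η ^ n) = 0 := by
  rw [← vermaSeq_closed_form]
  have : (1 - η) ^ 2 ≠ 0 := pow_ne_zero _ (sub_ne_zero.2 hη1.symm)
  simp [this]

/-- A zero at n ≥ 1 forces η^n ≠ 1, since nγ(1 - η) ≠ 0. Eliminating λ from the equations for m and
n leaves the equation of X_{m,n}; conversely the equation for m can be solved for λ. -/
theorem atMostOneZero_iff [CharZero K] {η γ : K} (hγ : γ ≠ 0) (hη0 : η ≠ 0) (hη1 : η ≠ 1) :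
    AtMostOneZero (1 + η) (-η) γ ↔ ∀ m n : ℕ, 1 ≤ m → 1 ≤ n → m ≠ n → η ∉ X K m n := by
  have h1η : 1 - η ≠ 0 := sub_ne_zero.2 hη1.symm
  constructor
  · rintro h m n hm hn hmn ⟨-, hηm, hηn, hX⟩
    refine hmn (h ((γ - m * γ * (1 - η) / (1 - η ^ m)) / (1 - η)) m n hm hn ?_ ?_)
    all_goals
      rw [vermaSeq_eq_zero_iff hη1]
      have h1 : 1 - η ^ m ≠ 0 := sub_ne_zero.2 (Ne.symm hηm)
      field_simp
    · ring
    · linear_combination -γ * (1 - η) * hX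
  · intro h lam m n hm hn h1 h2
    rw [vermaSeq_eq_zero_iff hη1] at h1 h2
    by_contra hmn
    have key : ∀ k : ℕ, 1 ≤ k →
        k * γ * (1 - η) + ((1 - η) * lam - γ) * (1 - η ^ k) = 0 →
          ((1 - η) * lam - γ) * (1 - η ^ k) ≠ 0 := by
      intro k hk h3 h4
      rw [h4, add_zero] at h3
      have : (k : K) ≠ 0 := by exact_mod_cast (by omega : k ≠ 0)
      exact mul_ne_zero (mul_ne_zero this hγ) h1η h3
    have hm' := key m hm h1
    have hn' := key n hn h2
    refine h m n hm hn hmn ⟨hη0, ?_, ?_, ?_⟩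
    · rintro h3; simp [h3] at hm'
    · rintro h3; simp [h3] at hn'
    · refine mul_left_cancel₀ (left_ne_zero_of_mul hm') ?_
      linear_combination m * h2 - n * h1

theorem eq_vermaSeq {α β γ : K} {s : ℕ → K} (h0 : s 0 = 0)
    (hs : ∀ k, s (k + 2) = α * s (k + 1) + β * s k + γ) (n : ℕ) :
    s n = vermaSeq α β γ (s 1) n := by
  induction n using Nat.twoStepInduction with
  | zero => simpa [vermaSeq]
  | one => simp [vermaSeq]
  | more n h1 h2 => rw [hs, vermaSeq, h1, h2]

/-- The sequence of the `λ_n` continued to the left: `backSeq α β γ lam n = λ_{-n}`. -/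
def backSeq (α β γ lam : K) : ℕ → K
  | 0 => lam
  | 1 => 0
  | n + 2 => β⁻¹ * (backSeq α β γ lam n - α * backSeq α β γ lam (n + 1) - γ)

theorem exists_extension {α β γ : K} (hβ : β ≠ 0) (lam : K) (j : ℕ) :
    ∃ s : ℕ → K, (∀ k, s (k + 2) = α * s (k + 1) + β * s k + γ) ∧
      s 0 = backSeq α β γ lam (j + 1) ∧ s 1 = backSeq α β γ lam j ∧
      ∀ t, s (j + t) = vermaSeq α β γ lam t := by
  induction j with
  | zero => exact ⟨vermaSeq α β γ lam, fun k => rfl, rfl, rfl, fun t => by rw [zero_add]⟩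
  | succ j ih =>
    obtain ⟨s, hs, h0, h1, ht⟩ := ih
    refine ⟨fun k => Nat.casesOn k (backSeq α β γ lam (j + 2)) s, ?_, rfl, h0, fun t => ?_⟩
    · rintro (_ | k)
      · change s 1 = α * s 0 + β * backSeq α β γ lam (j + 2) + γ
        rw [backSeq, h0, h1]
        field_simp
        ring
      · exact hs k
    · rw [Nat.add_right_comm]
      exact ht t

/-- A highest weight `λ` of a finite-dimensional module does not occur just above a lowest
weight. -/
theorem AtMostOneZero.backSeq_ne_zero {α β γ : K} (h : AtMostOneZero α β γ) (hβ : β ≠ 0) {lam : K}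
    {i : ℕ} (hi : 1 ≤ i) (hlam : vermaSeq α β γ lam i = 0) (j : ℕ) :
    backSeq α β γ lam (j + 2) ≠ 0 := by
  intro hj
  -- Started at λ_{-(j+2)} = 0, the sequence is again a `vermaSeq`. It vanishes at index j + 1,
  -- which is the old λ_{-1}, and at j + 1 + i.
  obtain ⟨s, hs, h0, -, ht⟩ := exists_extension hβ lam (j + 1) (α := α) (γ := γ)
  have hv := eq_vermaSeq (h0.trans hj) hs
  have := h (s 1) (j + 1) (j + 1 + i) (by omega) (by omega)
    (by rw [← hv]; simpa [vermaSeq] using ht 0) (by rw [← hv, ht, hlam])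
  omega

theorem vermaSeq_eq_add_mul (α β γ lam : K) (n : ℕ) :
    vermaSeq α β γ lam n = vermaSeq α β γ 0 n + vermaSeq α β 0 1 n * lam := by
  induction n using Nat.twoStepInduction with
  | zero => simp [vermaSeq]
  | one => simp [vermaSeq]
  | more n h1 h2 => simp only [vermaSeq, h1, h2]; ring

open Polynomial in
/-- The linear polynomial in `λ` whose values are the `λ_{n-1}`. -/
noncomputable def vermaPoly (α β γ : K) (n : ℕ) : K[X] :=
  C (vermaSeq α β γ 0 n) + C (vermaSeq α β 0 1 n) * Polynomial.X

theorem eval_vermaPoly (α β γ lam : K) (n : ℕ) :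
    (vermaPoly α β γ n).eval lam = vermaSeq α β γ lam n := by
  simp [vermaPoly, vermaSeq_eq_add_mul α β γ lam]

open Polynomial in
-- A common root of two factors would be a λ with two zeros. A factor with a multiple root, being of
-- degree at most one, would be identically zero.
theorem AtMostOneZero.squarefree_prod [IsAlgClosed K] {α β γ : K} (h : AtMostOneZero α β γ)
    (n : ℕ) : Squarefree (∏ i ∈ Finset.range n, vermaPoly α β γ (i + 1)) := by
  refine (separable_prod' ?_ ?_).squarefree
  · intro i _ j _ hij
    rw [isCoprime_iff_aeval_ne_zero_of_isAlgClosed K K]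
    intro lam
    simp only [coe_aeval_eq_eval, eval_vermaPoly]
    by_contra! hc
    exact hij (by simpa using h lam (i + 1) (j + 1) (by omega) (by omega) hc.1 hc.2)
  · intro i _
    rw [separable_def, isCoprime_iff_aeval_ne_zero_of_isAlgClosed K K]
    intro lam
    have hder : derivative (vermaPoly α β γ (i + 1)) = C (vermaSeq α β 0 1 (i + 1)) := by
      simp [vermaPoly]
    rw [hder]
    simp only [coe_aeval_eq_eval, eval_vermaPoly, eval_C]
    by_contra! hc
    have h0 : vermaSeq α β γ 0 (i + 1) = 0 := by
      rw [vermaSeq_eq_add_mul, hc.2] at hc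
      simpa using hc.1
    -- For λ = 0 the sequence already vanishes at index 1, which excludes all i except 0; there the
    -- slope is 1.
    have : i + 1 = 1 := h 0 (i + 1) 1 (by omega) le_rfl h0 rfl
    obtain rfl : i = 0 := by omega
    simpa [vermaSeq] using hc.2

end DownUp
-- Generators, submodules and homomorphisms
namespace DownUp

variable {K : Type u} [Field K]

section Algebra

variable (α β γ : K)

/-- The projection from the free algebra to the down-up algebra. -/
noncomputable def mk : FreeAlgebra K DownUpGen →ₐ[K] DownUpAlgebra α β γ :=
  RingQuot.mkAlgHom K (Rel α β γ)

theorem mk_surjective : Function.Surjective (mk α β γ) :=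
  RingQuot.mkAlgHom_surjective K (Rel α β γ)

/-- The generator `d` of the down-up algebra. -/
noncomputable def gd : DownUpAlgebra α β γ := mk α β γ fd

/-- The generator `u` of the down-up algebra. -/
noncomputable def gu : DownUpAlgebra α β γ := mk α β γ fu

theorem gd_gd_gu : gd α β γ * gd α β γ * gu α β γ =
    α • (gd α β γ * gu α β γ * gd α β γ) + β • (gu α β γ * gd α β γ * gd α β γ) +
      γ • gd α β γ := by
  have := RingQuot.mkAlgHom_rel K (Rel.r1 (α := α) (β := β) (γ := γ))
  change mk α β γ _ = mk α β γ _ at this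
  simp only [map_add, map_smul, map_mul] at this
  exact this

theorem gd_gu_gu : gd α β γ * gu α β γ * gu α β γ =
    α • (gu α β γ * gd α β γ * gu α β γ) + β • (gu α β γ * gu α β γ * gd α β γ) +
      γ • gu α β γ := by
  have := RingQuot.mkAlgHom_rel K (Rel.r2 (α := α) (β := β) (γ := γ))
  change mk α β γ _ = mk α β γ _ at this
  simp only [map_add, map_smul, map_mul] at this
  exact this

variable {α β γ}

theorem generator_induction {C : DownUpAlgebra α β γ → Prop} (hd : C (gd α β γ))
    (hu : C (gu α β γ)) (hK : ∀ c : K, C (algebraMap K _ c)) (hadd : ∀ a b, C a → C b → C (a + b))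
    (hmul : ∀ a b, C a → C b → C (a * b)) (a : DownUpAlgebra α β γ) : C a := by
  obtain ⟨x, rfl⟩ := mk_surjective α β γ a
  induction x using FreeAlgebra.induction with
  | grade0 c => rw [AlgHom.commutes]; exact hK c
  | grade1 g => cases g; exacts [hd, hu]
  | mul a b ha hb => rw [map_mul]; exact hmul _ _ ha hb
  | add a b ha hb => rw [map_add]; exact hadd _ _ ha hb

variable {M N : Type*} [AddCommGroup M] [Module K M] [Module (DownUpAlgebra α β γ) M]
  [IsScalarTower K (DownUpAlgebra α β γ) M]

/-- A subspace stable under `d` and `u` as a submodule. -/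
def submoduleOfStable (p : Submodule K M) (hd : ∀ x ∈ p, gd α β γ • x ∈ p)
    (hu : ∀ x ∈ p, gu α β γ • x ∈ p) : Submodule (DownUpAlgebra α β γ) M where
  __ := p.toAddSubmonoid
  smul_mem' a x hx := by
    refine generator_induction (C := fun a => ∀ x : M, x ∈ p → a • x ∈ p) hd hu ?_ ?_ ?_ a x hx
    · intro c x hx
      rw [algebraMap_smul]
      exact p.smul_mem c hx
    · intro a b ha hb x hx
      rw [add_smul]
      exact p.add_mem (ha x hx) (hb x hx)
    · intro a b ha hb x hx
      rw [mul_smul]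
      exact ha _ (hb x hx)

@[simp]
theorem mem_submoduleOfStable {p : Submodule K M} {hd : ∀ x ∈ p, gd α β γ • x ∈ p}
    {hu : ∀ x ∈ p, gu α β γ • x ∈ p} {x : M} : x ∈ submoduleOfStable p hd hu ↔ x ∈ p :=
  Iff.rfl

variable [AddCommGroup N] [Module K N] [Module (DownUpAlgebra α β γ) N]
  [IsScalarTower K (DownUpAlgebra α β γ) N]

/-- A linear map commuting with `d` and `u` as a module homomorphism. -/
def homOfCommute (f : M →ₗ[K] N) (hd : ∀ x, f (gd α β γ • x) = gd α β γ • f x)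
    (hu : ∀ x, f (gu α β γ • x) = gu α β γ • f x) : M →ₗ[DownUpAlgebra α β γ] N where
  __ := f.toAddHom
  map_smul' a := by
    refine generator_induction (C := fun a => ∀ x : M, f (a • x) = a • f x) hd hu ?_ ?_ ?_ a
    · intro c x
      rw [algebraMap_smul, algebraMap_smul, map_smul]
    · intro a b ha hb x
      rw [add_smul, add_smul, map_add, ha, hb]
    · intro a b ha hb x
      rw [mul_smul, mul_smul, ha, hb]

end Algebra

/-! ### Submodules and length of Verma modules -/

section Verma

variable {α β γ lam : K}

theorem vermaSeq_zero : vermaSeq α β γ lam 0 = 0 := rfl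

instance : IsScalarTower K (DownUpAlgebra α β γ) (DownUpVerma α β γ lam) where
  smul_assoc c a x := by
    change vermaRep α β γ lam (c • a) x = c • vermaRep α β γ lam a x
    rw [map_smul]
    rfl

/-- The basis vector `v_n` of the Verma module. -/
noncomputable def basisVec (α β γ lam : K) (n : ℕ) : DownUpVerma α β γ lam :=
  Finsupp.single n (1 : K)

/-- The coordinates of a vector of the Verma module. -/
def coord (n : ℕ) : DownUpVerma α β γ lam →ₗ[K] K := Finsupp.lapply (R := K) (M := K) n

theorem coord_ext {x y : DownUpVerma α β γ lam} (h : ∀ n, coord n x = coord n y) : x = y :=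
  Finsupp.ext h

theorem coord_basisVec (m n : ℕ) :
    coord m (basisVec α β γ lam n) = if n = m then 1 else 0 := by
  classical
  exact Finsupp.single_apply

theorem gd_smul (x : DownUpVerma α β γ lam) : gd α β γ • x = vermaD α β γ lam x := by
  change vermaRep α β γ lam (gd α β γ) x = _
  congr 1
  change RingQuot.liftAlgHom K _ (RingQuot.mkAlgHom K (Rel α β γ) fd) = _
  rw [RingQuot.liftAlgHom_mkAlgHom_apply, FreeAlgebra.lift_ι_apply]
  rfl

theorem gu_smul (x : DownUpVerma α β γ lam) : gu α β γ • x = vermaU K x := by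
  change vermaRep α β γ lam (gu α β γ) x = _
  congr 1
  change RingQuot.liftAlgHom K _ (RingQuot.mkAlgHom K (Rel α β γ) fu) = _
  rw [RingQuot.liftAlgHom_mkAlgHom_apply, FreeAlgebra.lift_ι_apply]
  rfl

theorem gd_basisVec_succ (n : ℕ) : gd α β γ • basisVec α β γ lam (n + 1) =
    vermaSeq α β γ lam (n + 1) • basisVec α β γ lam n := by
  rw [gd_smul]
  refine (vermaD_single α β γ lam (n + 1) 1).trans ?_
  refine Eq.trans ?_ (Finsupp.smul_single_one n _).symm
  rw [one_mul]
  rfl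

theorem gd_basisVec_zero : gd α β γ • basisVec α β γ lam 0 = 0 := by
  rw [gd_smul]
  refine (vermaD_single α β γ lam 0 1).trans ?_
  rw [vermaSeq, mul_zero, Finsupp.single_zero]
  rfl

theorem gu_basisVec (n : ℕ) :
    gu α β γ • basisVec α β γ lam n = basisVec α β γ lam (n + 1) := by
  rw [gu_smul]
  exact vermaU_single n 1

/-- Linear maps on the Verma module agree if they agree on the basis. -/
theorem verma_hom_ext {N : Type*} [AddCommGroup N] [Module K N]
    {f g : DownUpVerma α β γ lam →ₗ[K] N}
    (h : ∀ n, f (basisVec α β γ lam n) = g (basisVec α β γ lam n)) : f = g :=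
  Finsupp.lhom_ext' (M := K) (φ := f) (ψ := g) fun n => LinearMap.ext_ring (h n)

/-- The linear map on the Verma module with given values on the basis. -/
noncomputable def vermaLift {N : Type*} [AddCommGroup N] [Module K N] (w : ℕ → N) :
    DownUpVerma α β γ lam →ₗ[K] N :=
  Finsupp.lsum K fun k => LinearMap.toSpanSingleton K N (w k)

theorem vermaLift_basisVec {N : Type*} [AddCommGroup N] [Module K N] (w : ℕ → N)
    (n : ℕ) :
    vermaLift w (basisVec α β γ lam n) = w n :=
  (Finsupp.lsum_single K (fun k => LinearMap.toSpanSingleton K N (w k)) n (1 : K)).trans (by simp)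

/-- The action of an element of the algebra as a linear endomorphism. -/
noncomputable abbrev act {M : Type*} [AddCommGroup M] [Module K M] [Module (DownUpAlgebra α β γ) M]
    [IsScalarTower K (DownUpAlgebra α β γ) M] (a : DownUpAlgebra α β γ) : Module.End K M :=
  Algebra.lsmul K K M a

theorem coord_gd (n : ℕ) (x : DownUpVerma α β γ lam) :
    coord n (gd α β γ • x) = vermaSeq α β γ lam (n + 1) * coord (n + 1) x := by
  suffices h : coord n ∘ₗ act (gd α β γ) =
      vermaSeq α β γ lam (n + 1) • (coord (n + 1) : DownUpVerma α β γ lam →ₗ[K] K) from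
    LinearMap.congr_fun h x
  refine verma_hom_ext fun k => ?_
  rcases k with _ | k
  · simp [gd_basisVec_zero, coord_basisVec]
  · simp only [LinearMap.comp_apply, Algebra.lsmul_apply, gd_basisVec_succ, map_smul,
      coord_basisVec, LinearMap.smul_apply, smul_eq_mul, Nat.add_right_cancel_iff]
    split_ifs with h
    · rw [h]
    · simp

theorem coord_gu_succ (n : ℕ) (x : DownUpVerma α β γ lam) :
    coord (n + 1) (gu α β γ • x) = coord n x := by
  suffices h : coord (n + 1) ∘ₗ act (gu α β γ) =
      (coord n : DownUpVerma α β γ lam →ₗ[K] K) from LinearMap.congr_fun h x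
  refine verma_hom_ext fun k => ?_
  simp [gu_basisVec, coord_basisVec]

theorem coord_gu_zero (x : DownUpVerma α β γ lam) : coord 0 (gu α β γ • x) = 0 := by
  suffices h : coord 0 ∘ₗ act (gu α β γ) =
      (0 : DownUpVerma α β γ lam →ₗ[K] K) from LinearMap.congr_fun h x
  refine verma_hom_ext fun k => ?_
  simp [gu_basisVec, coord_basisVec]

/-- The submodule spanned by `v_n, v_{n+1}, …`, when `d v_n = 0`. -/
noncomputable def tail (n : ℕ) (hn : vermaSeq α β γ lam n = 0) :
    Submodule (DownUpAlgebra α β γ) (DownUpVerma α β γ lam) :=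
  submoduleOfStable (⨅ k : Fin n, LinearMap.ker (coord k.1))
    (by
      intro x hx
      simp only [Submodule.mem_iInf, LinearMap.mem_ker, coord_gd] at hx ⊢
      intro k
      rcases eq_or_ne (k.1 + 1) n with h | h
      · rw [h, hn, zero_mul]
      · rw [hx ⟨k.1 + 1, by omega⟩, mul_zero])
    (by
      intro x hx
      simp only [Submodule.mem_iInf, LinearMap.mem_ker] at hx ⊢
      rintro ⟨_ | k, hk⟩
      · exact coord_gu_zero x
      · rw [coord_gu_succ]
        exact hx ⟨k, by omega⟩)

theorem mem_tail {n : ℕ} {hn : vermaSeq α β γ lam n = 0} {x : DownUpVerma α β γ lam} :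
    x ∈ tail n hn ↔ ∀ k < n, coord k x = 0 := by
  simp only [tail, mem_submoduleOfStable, Submodule.mem_iInf, LinearMap.mem_ker]
  exact ⟨fun h k hk => h ⟨k, hk⟩, fun h k => h k.1 k.2⟩

theorem tail_zero (h : vermaSeq α β γ lam 0 = 0) : tail 0 h = ⊤ :=
  eq_top_iff.2 fun x _ => mem_tail.2 (by simp)

theorem basisVec_mem_tail {n k : ℕ} {hn : vermaSeq α β γ lam n = 0} :
    basisVec α β γ lam k ∈ tail n hn ↔ n ≤ k := by
  simp only [mem_tail, coord_basisVec]
  constructor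
  · intro h
    by_contra! hk
    simpa using h k hk
  · intro h j hj
    rw [if_neg (by omega)]

theorem eq_sum_basisVec (x : DownUpVerma α β γ lam) :
    ∃ s : Finset ℕ, (∀ k, k ∈ s ↔ coord k x ≠ 0) ∧
      x = ∑ k ∈ s, coord k x • basisVec α β γ lam k := by
  refine ⟨Finsupp.support (M := K) x, fun k => Finsupp.mem_support_iff, ?_⟩
  conv_lhs => rw [← Finsupp.sum_single (M := K) x]
  exact Finset.sum_congr rfl fun k _ => (Finsupp.smul_single_one k _).symm

theorem tail_le_of_basisVec_mem {n : ℕ} (hn : vermaSeq α β γ lam n = 0)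
    {N : Submodule (DownUpAlgebra α β γ) (DownUpVerma α β γ lam)}
    (h : basisVec α β γ lam n ∈ N) : tail n hn ≤ N := by
  have hb : ∀ j, basisVec α β γ lam (n + j) ∈ N := by
    intro j
    induction j with
    | zero => exact h
    | succ j ih => rw [← add_assoc, ← gu_basisVec]; exact N.smul_mem _ ih
  intro x hx
  obtain ⟨s, hs, hsum⟩ := eq_sum_basisVec x
  rw [hsum]
  refine N.sum_mem fun k hk => N.smul_of_tower_mem _ ?_
  have hnk : n ≤ k := by
    by_contra! hlt
    exact (hs k).1 hk (mem_tail.1 hx k hlt)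
  obtain ⟨j, rfl⟩ := Nat.exists_eq_add_of_le hnk
  exact hb j

/-- A submodule containing a vector with support in `[l, l + j]` and nonzero top coefficient
contains `v_l` if `d` does not vanish on `v_{l+1}, …, v_{l+j}`. -/
theorem tail_le_of_mem {l : ℕ} (hl : vermaSeq α β γ lam l = 0)
    {N : Submodule (DownUpAlgebra α β γ) (DownUpVerma α β γ lam)} (j : ℕ)
    (hS : ∀ i, l < i → i ≤ l + j → vermaSeq α β γ lam i ≠ 0) {x : DownUpVerma α β γ lam}
    (hx : x ∈ N) (htop : coord (l + j) x ≠ 0) (habove : ∀ i, l + j < i → coord i x = 0)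
    (hxl : x ∈ tail l hl) : tail l hl ≤ N := by
  induction j generalizing x with
  | zero =>
    refine tail_le_of_basisVec_mem hl ?_
    have hxe : x = coord l x • basisVec α β γ lam l := by
      refine coord_ext fun k => ?_
      rw [map_smul, coord_basisVec]
      rcases lt_trichotomy k l with h | h | h
      · rw [mem_tail.1 hxl k h, if_neg (by omega), smul_zero]
      · simp [h]
      · rw [habove k (by omega), if_neg (by omega), smul_zero]
    have hc : coord l x ≠ 0 := htop
    have : basisVec α β γ lam l = (coord l x)⁻¹ • x := by
      conv_rhs => rw [hxe]
      simp only [map_smul, coord_basisVec, if_true, smul_eq_mul, mul_one]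
      rw [inv_smul_smul₀ hc]
    rw [this]
    exact N.smul_of_tower_mem _ hx
  | succ j ih =>
    -- Applying d lowers the top degree by one and multiplies the top coefficient by a nonzero λ.
    refine ih (fun i h1 h2 => hS i h1 (by omega)) (N.smul_mem (gd α β γ) hx) ?_ ?_
      ((tail l hl).smul_mem _ hxl)
    · rw [coord_gd]
      exact mul_ne_zero (hS _ (by omega) (by omega)) htop
    · intro i hi
      rw [coord_gd, habove _ (by omega), mul_zero]

theorem exists_top_coord {x : DownUpVerma α β γ lam} (hx : x ≠ 0) :
    ∃ k, coord k x ≠ 0 ∧ ∀ i, k < i → coord i x = 0 := by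
  obtain ⟨s, hs, hsum⟩ := eq_sum_basisVec x
  have hne : s.Nonempty := by
    rw [Finset.nonempty_iff_ne_empty]
    rintro rfl
    exact hx (by simpa using hsum)
  refine ⟨s.max' hne, (hs _).1 (s.max'_mem hne), fun i hi => ?_⟩
  by_contra h
  exact absurd (s.le_max' i ((hs i).2 h)) (by omega)

theorem isAtom_tail {n : ℕ} (hn : vermaSeq α β γ lam n = 0)
    (hS : ∀ i, n < i → vermaSeq α β γ lam i ≠ 0) : IsAtom (tail n hn) := by
  rw [isAtom_iff_le_of_ge]
  refine ⟨fun h => ?_, fun N hN hle => ?_⟩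
  · have : basisVec α β γ lam n ∈ tail n hn := basisVec_mem_tail.2 le_rfl
    rw [h, Submodule.mem_bot] at this
    have h1 := congrArg (coord n) this
    rw [coord_basisVec, if_pos rfl, map_zero] at h1
    exact one_ne_zero h1
  · obtain ⟨x, hx, hx0⟩ := N.exists_mem_ne_zero_of_ne_bot hN
    obtain ⟨k, hk, habove⟩ := exists_top_coord hx0
    have hnk : n ≤ k := by
      by_contra! h
      exact hk (mem_tail.1 (hle hx) k h)
    obtain ⟨j, rfl⟩ := Nat.exists_eq_add_of_le hnk
    exact tail_le_of_mem hn j (fun i h _ => hS i h) hx hk habove (hle hx)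

/-- Truncation of a vector below degree `n`. -/
theorem exists_truncation {n : ℕ} (hn : vermaSeq α β γ lam n = 0) (x : DownUpVerma α β γ lam) :
    ∃ y : DownUpVerma α β γ lam, x - y ∈ tail n hn ∧ (∀ k, n ≤ k → coord k y = 0) ∧
      y ∈ Submodule.span K (Set.range fun k : Fin n => basisVec α β γ lam k) := by
  refine ⟨∑ k : Fin n, coord k.1 x • basisVec α β γ lam k, ?_, ?_, ?_⟩
  · rw [mem_tail]
    intro k hk
    rw [map_sub, map_sum, Finset.sum_eq_single ⟨k, hk⟩]
    · simp [coord_basisVec]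
    · intro b _ hb
      rw [map_smul, coord_basisVec, if_neg (fun h => hb (Fin.ext h)), smul_zero]
    · simp
  · intro k hk
    rw [map_sum]
    refine Finset.sum_eq_zero fun b _ => ?_
    rw [map_smul, coord_basisVec, if_neg (by omega), smul_zero]
  · exact Submodule.sum_mem _ fun k _ =>
      Submodule.smul_mem _ _ (Submodule.subset_span ⟨k, rfl⟩)

/-- A vector outside the tail can be truncated below degree n without leaving the larger submodule;
powers of d then bring it down to a nonzero multiple of v_0, which generates everything. -/
theorem isCoatom_tail {n : ℕ} (hn1 : 1 ≤ n) (hn : vermaSeq α β γ lam n = 0)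
    (hS : ∀ i, 1 ≤ i → i < n → vermaSeq α β γ lam i ≠ 0) : IsCoatom (tail n hn) := by
  refine ⟨fun h => ?_, fun N hN => ?_⟩
  · have : basisVec α β γ lam 0 ∈ tail n hn := h ▸ Submodule.mem_top
    rw [basisVec_mem_tail] at this
    omega
  · obtain ⟨x, hx, hxn⟩ := SetLike.exists_of_lt hN
    obtain ⟨y, hxy, hy, -⟩ := exists_truncation hn x
    have hyN : y ∈ N := by
      have := N.sub_mem hx (hN.le hxy)
      rwa [sub_sub_cancel] at this
    have hy0 : y ≠ 0 := by
      rintro rfl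
      exact hxn (by simpa using hxy)
    obtain ⟨k, hk, habove⟩ := exists_top_coord hy0
    have hkn : k < n := by
      by_contra! h
      exact hk (hy k h)
    rw [eq_top_iff, ← tail_zero (α := α) (β := β) (γ := γ) (lam := lam) vermaSeq_zero]
    exact tail_le_of_mem vermaSeq_zero k (fun i h1 h2 => hS i h1 (by omega)) hyN (by rwa [zero_add])
      (by rwa [zero_add]) (by rw [tail_zero]; trivial)

theorem AtMostOneZero.length_le_two (h : AtMostOneZero α β γ) (lam : K) :
    Module.length (DownUpAlgebra α β γ) (DownUpVerma α β γ lam) ≤ 2 := by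
  by_cases hz : ∃ n, 1 ≤ n ∧ vermaSeq α β γ lam n = 0
  · obtain ⟨n, hn1, hn⟩ := hz
    have h1 : IsSimpleModule (DownUpAlgebra α β γ) (tail n hn) := isSimpleModule_iff_isAtom.2
      (isAtom_tail hn fun i hi h0 => by
        have := h lam i n (by omega) hn1 h0 hn
        omega)
    have h2 : IsSimpleModule (DownUpAlgebra α β γ) (DownUpVerma α β γ lam ⧸ tail n hn) :=
      isSimpleModule_iff_isCoatom.2 (isCoatom_tail hn1 hn fun i hi hin h0 => by
        have := h lam i n hi hn1 h0 hn
        omega)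
    rw [Module.length_eq_add_of_exact (tail n hn).subtype (tail n hn).mkQ
      (Submodule.subtype_injective _) (Submodule.mkQ_surjective _)
      (LinearMap.exact_subtype_mkQ _), Module.length_eq_one, Module.length_eq_one,
      one_add_one_eq_two]
  · push Not at hz
    have h1 : IsSimpleModule (DownUpAlgebra α β γ) (⊤ : Submodule (DownUpAlgebra α β γ)
        (DownUpVerma α β γ lam)) := by
      rw [isSimpleModule_iff_isAtom, ← tail_zero vermaSeq_zero]
      exact isAtom_tail vermaSeq_zero hz
    rw [← Module.length_top, Module.length_eq_one]
    exact one_le_two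

theorem tail_lt_tail {m n : ℕ} (hm : vermaSeq α β γ lam m = 0) (hn : vermaSeq α β γ lam n = 0)
    (hmn : m < n) : tail n hn < tail m hm := by
  refine SetLike.lt_iff_le_and_exists.2 ⟨tail_le_of_basisVec_mem hn
    (basisVec_mem_tail.2 hmn.le), basisVec α β γ lam m, basisVec_mem_tail.2 le_rfl, ?_⟩
  rw [basisVec_mem_tail]
  omega

theorem two_lt_length {m n : ℕ} (hm1 : 1 ≤ m) (hm : vermaSeq α β γ lam m = 0)
    (hn : vermaSeq α β γ lam n = 0) (hmn : m < n) :
    2 < Module.length (DownUpAlgebra α β γ) (DownUpVerma α β γ lam) := by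
  by_contra! hlen
  -- Finite length makes the height of submodules strictly monotone, so the chain ⊥ < `tail n` <
  -- `tail m` < ⊤ forces length at least 3.
  have hfin := isFiniteLength_iff_isNoetherian_isArtinian.1
    (Module.length_ne_top_iff.1 (ne_top_of_le_ne_top (ENat.natCast_ne_top 2) hlen))
  have := hfin.1
  have := hfin.2
  have hbot : (⊥ : Submodule (DownUpAlgebra α β γ) (DownUpVerma α β γ lam)) < tail n hn := by
    rw [bot_lt_iff_ne_bot]
    intro h
    have h1 : basisVec α β γ lam n ∈ tail n hn := basisVec_mem_tail.2 le_rfl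
    rw [h, Submodule.mem_bot] at h1
    have h2 := congrArg (coord n) h1
    rw [coord_basisVec, if_pos rfl, map_zero] at h2
    exact one_ne_zero h2
  have h1 := Order.add_one_le_of_lt (Submodule.height_strictMono hbot)
  have h2 := Order.add_one_le_of_lt (Submodule.height_strictMono (tail_lt_tail hm hn hmn))
  have h3 := Order.add_one_le_of_lt (Submodule.height_strictMono
    (tail_lt_tail vermaSeq_zero hm hm1))
  rw [tail_zero, ← Module.length_eq_height] at h3
  have h4 : (0 + 1 + 1 + 1 : ℕ∞) ≤ 2 := by
    refine le_trans (le_trans ?_ h3) hlen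
    refine add_le_add_left (le_trans ?_ h2) 1
    exact add_le_add_left (le_trans (add_le_add_left zero_le 1) h1) 1
  exact absurd h4 (by decide)

theorem atMostOneZero_of_length_le_two
    (h : ∀ lam : K, Module.length (DownUpAlgebra α β γ) (DownUpVerma α β γ lam) ≤ 2) :
    AtMostOneZero α β γ := by
  intro lam m n hm hn hm0 hn0
  rcases lt_trichotomy m n with hmn | hmn | hmn
  · exact absurd (h lam) (not_le.2 (two_lt_length hm hm0 hn0 hmn))
  · exact hmn
  · exact absurd (h lam) (not_le.2 (two_lt_length hn hn0 hm0 hmn))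

instance finiteDimensional_quotient_tail {n : ℕ} (hn : vermaSeq α β γ lam n = 0) :
    FiniteDimensional K (DownUpVerma α β γ lam ⧸ tail n hn) := by
  set q := ((tail n hn).mkQ).restrictScalars K with hq
  have htop : Submodule.map q (Submodule.span K
      (Set.range fun k : Fin n => basisVec α β γ lam k)) = ⊤ := by
    rw [eq_top_iff]
    rintro z -
    obtain ⟨x, rfl⟩ := (tail n hn).mkQ_surjective z
    obtain ⟨y, hxy, -, hy⟩ := exists_truncation hn x
    exact ⟨y, hy, ((Submodule.Quotient.eq _).2 hxy).symm⟩
  refine Module.finite_def.2 (htop ▸ Submodule.FG.map _ (Submodule.fg_span (Set.finite_range _)))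

/-- Given a complement C of the image of `tail m`, write v_0 = x + c modulo `tail n`. Then u^m(v_0 -
x) maps into both summands, hence to zero, although its coefficient at v_m is 1 and m < n. -/
theorem not_isSemisimpleModule_quotient_tail {m n : ℕ} (hm1 : 1 ≤ m)
    (hm : vermaSeq α β γ lam m = 0) (hn : vermaSeq α β γ lam n = 0) (hmn : m < n) :
    ¬ IsSemisimpleModule (DownUpAlgebra α β γ) (DownUpVerma α β γ lam ⧸ tail n hn) := by
  intro hss
  obtain ⟨C, hC⟩ := exists_isCompl (Submodule.map (tail n hn).mkQ (tail m hm))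
  have h0 : (tail n hn).mkQ (basisVec α β γ lam 0) ∈
      Submodule.map (tail n hn).mkQ (tail m hm) ⊔ C := hC.sup_eq_top ▸ Submodule.mem_top
  obtain ⟨_, ⟨x, hx, rfl⟩, c, hc, hsum⟩ := Submodule.mem_sup.1 h0
  have hcoord : ∀ (j k : ℕ) (z : DownUpVerma α β γ lam),
      coord (k + j) (gu α β γ ^ j • z) = coord k z := by
    intro j
    induction j with
    | zero => simp
    | succ j ih =>
      intro k z
      rw [pow_succ', mul_smul, ← add_assoc, coord_gu_succ, ih]
  have hcoord0 : ∀ (j k : ℕ) (z : DownUpVerma α β γ lam), k < j →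
      coord k (gu α β γ ^ j • z) = 0 := by
    intro j
    induction j with
    | zero => simp
    | succ j ih =>
      intro k z hk
      rw [pow_succ', mul_smul]
      rcases k with _ | k
      · rw [coord_gu_zero]
      · rw [coord_gu_succ, ih k z (by omega)]
  set y := gu α β γ ^ m • (basisVec α β γ lam 0 - x) with hy
  have hyc : (tail n hn).mkQ y = gu α β γ ^ m • c := by
    rw [hy, map_smul, map_sub, ← hsum, add_sub_cancel_left]
  have hy0 : (tail n hn).mkQ y = 0 := by
    refine (Submodule.disjoint_def.1 hC.disjoint) _ ⟨y, ?_, rfl⟩ (hyc ▸ C.smul_mem _ hc)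
    exact mem_tail.2 fun k hk => hcoord0 m k _ hk
  have hyn : y ∈ tail n hn := by
    rwa [Submodule.mkQ_apply, Submodule.Quotient.mk_eq_zero] at hy0
  have h1 := mem_tail.1 hyn (0 + m) (by omega)
  rw [hy, hcoord, map_sub, coord_basisVec, if_pos rfl, mem_tail.1 hx 0 hm1, sub_zero] at h1
  exact one_ne_zero h1

theorem atMostOneZero_of_isSemisimpleModule
    (h : ∀ (M : Type u) [AddCommGroup M] [Module K M] [Module (DownUpAlgebra α β γ) M]
      [IsScalarTower K (DownUpAlgebra α β γ) M] [FiniteDimensional K M],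
      IsSemisimpleModule (DownUpAlgebra α β γ) M) : AtMostOneZero α β γ := by
  intro lam m n hm hn hm0 hn0
  rcases lt_trichotomy m n with hmn | hmn | hmn
  · exact absurd (h _) (not_isSemisimpleModule_quotient_tail hm hm0 hn0 hmn)
  · exact hmn
  · exact absurd (h _) (not_isSemisimpleModule_quotient_tail hn hn0 hm0 hmn)

end Verma

end DownUp
-- Commutation with powers of the generators
namespace DownUp

variable {K : Type u} [Field K]

section Identities

variable (α β γ : K)

/-- The elements `u d`, `d u`, … obtained by moving `u d` to the right past powers of `u`. -/
noncomputable def raiseSeq : ℕ → DownUpAlgebra α β γ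
  | 0 => gu α β γ * gd α β γ
  | 1 => gd α β γ * gu α β γ
  | n + 2 => α • raiseSeq (n + 1) + β • raiseSeq n + γ • 1

/-- The elements `α d u + β u d + γ`, `d u`, `u d`, … obtained by moving the first of them to the
right past powers of `d`. -/
noncomputable def lowerSeq : ℕ → DownUpAlgebra α β γ
  | 0 => raiseSeq α β γ 2
  | 1 => gd α β γ * gu α β γ
  | n + 2 => β⁻¹ • (lowerSeq n - α • lowerSeq (n + 1) - γ • 1)

/-- The case 0 is associativity and the case 1 is the second defining relation; linearity of the
recursion gives the rest. -/
theorem raiseSeq_mul_gu (k : ℕ) :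
    raiseSeq α β γ k * gu α β γ = gu α β γ * raiseSeq α β γ (k + 1) := by
  induction k using Nat.twoStepInduction with
  | zero => simp only [raiseSeq, mul_assoc]
  | one =>
    simp only [raiseSeq, mul_add, mul_smul_comm, mul_one, ← mul_assoc]
    exact gd_gu_gu α β γ
  | more n h1 h2 =>
    rw [raiseSeq, add_mul, add_mul, smul_mul_assoc, smul_mul_assoc, smul_mul_assoc, h1, h2]
    conv_rhs => rw [raiseSeq]
    simp only [mul_add, mul_smul_comm, mul_one, one_mul]

theorem raiseSeq_mul_gu_pow (j k : ℕ) :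
    raiseSeq α β γ j * gu α β γ ^ k = gu α β γ ^ k * raiseSeq α β γ (j + k) := by
  induction k with
  | zero => simp
  | succ k ih => rw [pow_succ, ← mul_assoc, ih, mul_assoc, raiseSeq_mul_gu, mul_assoc, add_assoc]

theorem gd_mul_gu_pow_succ (k : ℕ) :
    gd α β γ * gu α β γ ^ (k + 1) = gu α β γ ^ k * raiseSeq α β γ (k + 1) := by
  rw [pow_succ', ← mul_assoc, add_comm k 1]
  exact raiseSeq_mul_gu_pow α β γ 1 k

theorem gd_pow_mul_gu_pow_succ (k : ℕ) : gd α β γ ^ (k + 1) * gu α β γ ^ (k + 1) =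
    gd α β γ ^ k * gu α β γ ^ k * raiseSeq α β γ (k + 1) := by
  rw [pow_succ (gd α β γ), mul_assoc, gd_mul_gu_pow_succ, mul_assoc]

variable {β} in
theorem lowerSeq_two (hβ : β ≠ 0) : lowerSeq α β γ 2 = gu α β γ * gd α β γ := by
  simp only [lowerSeq, raiseSeq]
  match_scalars <;> field_simp <;> ring

/-- The mirror image of `raiseSeq_mul_gu`, with the first defining relation as case 0. The recursion
runs backwards, so β must be invertible. -/
theorem lowerSeq_mul_gd (hβ : β ≠ 0) (k : ℕ) :
    lowerSeq α β γ k * gd α β γ = gd α β γ * lowerSeq α β γ (k + 1) := by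
  induction k using Nat.twoStepInduction with
  | zero =>
    simp only [lowerSeq, raiseSeq, add_mul, smul_mul_assoc, one_mul, ← mul_assoc]
    exact (gd_gd_gu α β γ).symm
  | one => rw [lowerSeq_two α γ hβ, lowerSeq, mul_assoc]
  | more n h1 h2 =>
    rw [lowerSeq, smul_mul_assoc, sub_mul, sub_mul, smul_mul_assoc, smul_mul_assoc, h1, h2]
    conv_rhs => rw [lowerSeq]
    simp only [mul_sub, mul_smul_comm, mul_one, one_mul]

theorem lowerSeq_mul_gd_pow (hβ : β ≠ 0) (j k : ℕ) :
    lowerSeq α β γ j * gd α β γ ^ k = gd α β γ ^ k * lowerSeq α β γ (j + k) := by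
  induction k with
  | zero => simp
  | succ k ih =>
    rw [pow_succ, ← mul_assoc, ih, mul_assoc, lowerSeq_mul_gd α β γ hβ, mul_assoc, add_assoc]

theorem gu_pow_mul_gd_pow_succ (hβ : β ≠ 0) (k : ℕ) : gu α β γ ^ (k + 1) * gd α β γ ^ (k + 1) =
    gu α β γ ^ k * gd α β γ ^ k * lowerSeq α β γ (k + 2) := by
  rw [pow_succ (gu α β γ), pow_succ' (gd α β γ), mul_assoc, ← mul_assoc (gu α β γ) (gd α β γ),
    ← lowerSeq_two α γ hβ, lowerSeq_mul_gd_pow α β γ hβ, mul_assoc, add_comm 2 k]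

end Identities

/-! ### Finite-dimensional modules and semisimplicity -/

section FiniteDimensional

variable {α β γ : K} {M : Type*} [AddCommGroup M] [Module K M] [Module (DownUpAlgebra α β γ) M]
  [IsScalarTower K (DownUpAlgebra α β γ) M]

/-- On ker d the element ud acts as zero, so the recursion becomes that of the λ_n with du in place
of λ. -/
theorem raiseSeq_smul {v : M} (hv : gd α β γ • v = 0) (k : ℕ) :
    raiseSeq α β γ k • v = vermaSeq α β γ 0 k • v +
      vermaSeq α β 0 1 k • (gd α β γ * gu α β γ) • v := by
  induction k using Nat.twoStepInduction with
  | zero => simp [raiseSeq, vermaSeq, mul_smul, hv]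
  | one => simp [raiseSeq, vermaSeq]
  | more n h1 h2 =>
    simp only [raiseSeq, vermaSeq, add_smul, smul_assoc, one_smul, h1, h2]
    generalize (gd α β γ * gu α β γ) • v = w
    module

theorem raiseSeq_smul_of_eigenvector {v : M} {lam : K} (hv : gd α β γ • v = 0)
    (hlam : (gd α β γ * gu α β γ) • v = lam • v) (k : ℕ) :
    raiseSeq α β γ k • v = vermaSeq α β γ lam k • v := by
  rw [raiseSeq_smul hv, hlam, vermaSeq_eq_add_mul α β γ lam, add_smul, smul_smul]

theorem gd_smul_gu_pow_succ_smul {v : M} {lam : K} (hv : gd α β γ • v = 0)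
    (hlam : (gd α β γ * gu α β γ) • v = lam • v) (k : ℕ) :
    gd α β γ • gu α β γ ^ (k + 1) • v = vermaSeq α β γ lam (k + 1) • gu α β γ ^ k • v := by
  rw [smul_smul, gd_mul_gu_pow_succ, mul_smul, raiseSeq_smul_of_eigenvector hv hlam,
    smul_comm]

theorem gd_smul_gd_mul_gu_smul {v : M} (hv : gd α β γ • v = 0) :
    gd α β γ • (gd α β γ * gu α β γ) • v = 0 := by
  rw [smul_smul, ← mul_assoc, gd_gd_gu]
  simp only [add_smul, smul_assoc, mul_smul, hv, smul_zero, add_zero]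

/-- The action of `d u` on the kernel of `d`. -/
noncomputable def weightEnd (α β γ : K) (M : Type*) [AddCommGroup M] [Module K M]
    [Module (DownUpAlgebra α β γ) M] [IsScalarTower K (DownUpAlgebra α β γ) M] :
    Module.End K (LinearMap.ker (act (gd α β γ) : Module.End K M)) :=
  (act (gd α β γ * gu α β γ) : Module.End K M).restrict fun _ hv => gd_smul_gd_mul_gu_smul hv

theorem coe_weightEnd (v : LinearMap.ker (act (gd α β γ) : Module.End K M)) :
    (weightEnd α β γ M v : M) = (gd α β γ * gu α β γ) • (v : M) :=
  rfl

/-- Once u^k = 0, this yields a polynomial annihilating du on ker d. -/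
theorem gd_pow_smul_gu_pow_smul (k : ℕ) (v : LinearMap.ker (act (gd α β γ) : Module.End K M)) :
    (gd α β γ ^ k * gu α β γ ^ k) • (v : M) = (Polynomial.aeval (weightEnd α β γ M)
      (∏ i ∈ Finset.range k, vermaPoly α β γ (i + 1)) v : M) := by
  induction k generalizing v with
  | zero => simp
  | succ k ih =>
    have h : raiseSeq α β γ (k + 1) • (v : M) =
        (Polynomial.aeval (weightEnd α β γ M) (vermaPoly α β γ (k + 1)) v : M) := by
      rw [raiseSeq_smul v.2]
      simp only [vermaPoly, map_add, map_mul, Polynomial.aeval_C, Polynomial.aeval_X,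
        Module.algebraMap_end_eq_smul_id, LinearMap.add_apply, Module.End.mul_apply,
        LinearMap.smul_apply, LinearMap.id_apply, Submodule.coe_add, Submodule.coe_smul,
        coe_weightEnd]
    rw [gd_pow_mul_gu_pow_succ, mul_smul, h, ih, Finset.prod_range_succ, map_mul,
      Module.End.mul_apply]

/-- With c = γ/(1 - η), the element w = du - ud - c satisfies wd = η⁻¹dw and wu = ηuw. Since (du)d =
d(ud) and (ud)u = u(du), the trace criterion `LinearMap.isNilpotent_of_intertwines` applies to both
generators. -/
theorem isNilpotent_generators [CharZero K] [FiniteDimensional K M] {η : K}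
    (hαη : α = 1 + η) (hβη : β = -η) (hγ : γ ≠ 0) (hη0 : η ≠ 0) (hη1 : η ≠ 1) :
    IsNilpotent (act (gd α β γ) : Module.End K M) ∧
      IsNilpotent (act (gu α β γ) : Module.End K M) := by
  obtain ⟨c, rfl⟩ : ∃ c, γ = c * (1 - η) :=
    ⟨γ / (1 - η), (div_mul_cancel₀ _ (sub_ne_zero.2 hη1.symm)).symm⟩
  have hc : c ≠ 0 := left_ne_zero_of_mul hγ
  subst hαη hβη
  set d := gd (1 + η) (-η) (c * (1 - η)) with hd
  set e := gu (1 + η) (-η) (c * (1 - η)) with he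
  have r1 : d * d * e = _ := gd_gd_gu (1 + η) (-η) (c * (1 - η))
  have r2 : d * e * e = _ := gd_gu_gu (1 + η) (-η) (c * (1 - η))
  rw [← hd, ← he] at r1 r2
  have hw1 : (d * e - e * d - c • 1) * d = η⁻¹ • (d * (d * e - e * d - c • 1)) := by
    simp only [sub_mul, mul_sub, smul_mul_assoc, mul_smul_comm, one_mul, mul_one, ← mul_assoc, r1]
    match_scalars <;> field_simp <;> ring
  have hw2 : (e * d - d * e - (-c) • 1) * e = η • (e * (e * d - d * e - (-c) • 1)) := by
    simp only [sub_mul, mul_sub, smul_mul_assoc, mul_smul_comm, one_mul, mul_one, ← mul_assoc, r2]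
    match_scalars <;> field_simp <;> ring
  constructor
  · refine LinearMap.isNilpotent_of_intertwines (a := act (d * e)) (b := act (e * d))
      (w := act (d * e - e * d - c • 1)) (ζ := η⁻¹) (c := c) ?_ ?_ ?_ hc ?_
    · rw [← map_mul, ← map_mul, mul_assoc]
    · rw [← map_mul, ← map_mul, ← map_smul, hw1]
    · simpa using hη1
    · simp only [map_sub, map_smul, map_one]
      abel
  · refine LinearMap.isNilpotent_of_intertwines (a := act (e * d)) (b := act (d * e))
      (w := act (e * d - d * e - (-c) • 1)) (ζ := η) (c := -c) ?_ ?_ hη1 (neg_ne_zero.2 hc) ?_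
    · rw [← map_mul, ← map_mul, mul_assoc]
    · rw [← map_mul, ← map_mul, ← map_smul, hw2]
    · simp only [map_sub, map_smul, map_one]
      abel

theorem smul_pow_eq_zero {a : DownUpAlgebra α β γ} {k : ℕ}
    (h : (act a : Module.End K M) ^ k = 0) (x : M) : a ^ k • x = 0 := by
  rw [← map_pow] at h
  exact LinearMap.congr_fun h x

/-- A highest weight vector on which `u` is nilpotent has a weight `λ` with `λ_{i-1} = 0`. -/
theorem exists_vermaSeq_eq_zero {v : M} {lam : K} (hv0 : v ≠ 0) (hv : gd α β γ • v = 0)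
    (hlam : (gd α β γ * gu α β γ) • v = lam • v)
    (hu : IsNilpotent (act (gu α β γ) : Module.End K M)) :
    ∃ i, 1 ≤ i ∧ vermaSeq α β γ lam i = 0 := by
  classical
  obtain ⟨k, hk⟩ := hu
  have hex : ∃ k, gu α β γ ^ k • v = 0 := ⟨k, smul_pow_eq_zero hk v⟩
  obtain ⟨j, hj⟩ : ∃ j, Nat.find hex = j + 1 := by
    refine Nat.exists_eq_succ_of_ne_zero fun h => hv0 ?_
    simpa [h] using Nat.find_spec hex
  refine ⟨j + 1, by omega, ?_⟩
  -- Here u^j v ≠ 0 = u^(j+1) v, so applying d to the latter shows that the coefficient λ_j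
  -- vanishes.
  have h1 := gd_smul_gu_pow_succ_smul hv hlam j
  rw [← hj, Nat.find_spec hex, smul_zero, hj] at h1
  exact (smul_eq_zero.1 h1.symm).resolve_right (Nat.find_min hex (by omega))

theorem exists_highest_weight_vector [IsAlgClosed K] [FiniteDimensional K M]
    [Nontrivial M]
    (hd : IsNilpotent (act (gd α β γ) : Module.End K M)) :
    ∃ (v : M) (lam : K), v ≠ 0 ∧ gd α β γ • v = 0 ∧ (gd α β γ * gu α β γ) • v = lam • v := by
  have : Nontrivial (LinearMap.ker (act (gd α β γ) : Module.End K M)) := by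
    rw [Submodule.nontrivial_iff_ne_bot]
    intro h
    obtain ⟨k, hk⟩ := hd
    have hinj := LinearMap.ker_eq_bot.1 h
    obtain ⟨x, hx⟩ := exists_ne (0 : M)
    refine hx ((hinj.iterate k) ?_)
    rw [← Module.End.pow_apply, hk]
    simp
  obtain ⟨lam, hlam⟩ := Module.End.exists_eigenvalue (weightEnd α β γ M)
  obtain ⟨v, hv⟩ := hlam.exists_hasEigenvector
  refine ⟨v, lam, fun h => hv.2 (Subtype.ext h), v.2, ?_⟩
  rw [← coe_weightEnd, hv.apply_eq_smul]
  rfl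

/-- The homomorphism from a Verma module determined by a highest weight vector. -/
noncomputable def vermaHom {v : M} {lam : K} (hv : gd α β γ • v = 0)
    (hlam : (gd α β γ * gu α β γ) • v = lam • v) :
    DownUpVerma α β γ lam →ₗ[DownUpAlgebra α β γ] M :=
  homOfCommute (vermaLift fun k => gu α β γ ^ k • v)
    (LinearMap.congr_fun (f := vermaLift _ ∘ₗ act (gd α β γ)) (g := act (gd α β γ) ∘ₗ vermaLift _)
      (verma_hom_ext fun n => by
        rcases n with _ | n
        · simp [gd_basisVec_zero, vermaLift_basisVec, hv]
        · simp only [LinearMap.comp_apply, Algebra.lsmul_apply, gd_basisVec_succ, map_smul,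
            vermaLift_basisVec, gd_smul_gu_pow_succ_smul hv hlam]))
    (LinearMap.congr_fun (f := vermaLift _ ∘ₗ act (gu α β γ)) (g := act (gu α β γ) ∘ₗ vermaLift _)
      (verma_hom_ext fun n => by
        simp only [LinearMap.comp_apply, Algebra.lsmul_apply, gu_basisVec,
          vermaLift_basisVec, smul_smul, pow_succ']))

theorem vermaHom_basisVec {v : M} {lam : K} (hv : gd α β γ • v = 0)
    (hlam : (gd α β γ * gu α β γ) • v = lam • v) (n : ℕ) :
    vermaHom hv hlam (basisVec α β γ lam n) = gu α β γ ^ n • v :=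
  vermaLift_basisVec _ n

/-- If Verma modules have length at most two, a highest weight vector on which `u` is nilpotent
lies in a simple submodule. -/
theorem exists_simple_mem {v : M} {lam : K} (hv0 : v ≠ 0) (hv : gd α β γ • v = 0)
    (hlam : (gd α β γ * gu α β γ) • v = lam • v)
    (hu : IsNilpotent (act (gu α β γ) : Module.End K M))
    (hlen : Module.length (DownUpAlgebra α β γ) (DownUpVerma α β γ lam) ≤ 2) :
    ∃ S : Submodule (DownUpAlgebra α β γ) M, IsSimpleModule (DownUpAlgebra α β γ) S ∧ v ∈ S := by
  set f := vermaHom hv hlam with hf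
  have hvf : v ∈ LinearMap.range f :=
    ⟨basisVec α β γ lam 0, by rw [hf, vermaHom_basisVec, pow_zero, one_smul]⟩
  refine ⟨LinearMap.range f, ?_, hvf⟩
  -- Since u^k kills v, the kernel contains v_k. In length at most two this leaves length one for
  -- the nonzero image.
  have hker : Nontrivial (LinearMap.ker f) := by
    obtain ⟨k, hk⟩ := hu
    rw [Submodule.nontrivial_iff_ne_bot, Submodule.ne_bot_iff]
    refine ⟨basisVec α β γ lam k, ?_, fun h => ?_⟩
    · rw [LinearMap.mem_ker, hf, vermaHom_basisVec, smul_pow_eq_zero hk]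
    · have h1 := congrArg (coord k) h
      rw [coord_basisVec, if_pos rfl, map_zero] at h1
      exact one_ne_zero h1
  have hrange : Nontrivial (LinearMap.range f) :=
    ⟨⟨⟨v, hvf⟩, 0, fun h => hv0 (congrArg Subtype.val h)⟩⟩
  rw [Module.length_eq_add_of_exact (LinearMap.ker f).subtype f.rangeRestrict
    (Submodule.subtype_injective _) f.surjective_rangeRestrict
    (by rw [LinearMap.exact_iff, LinearMap.ker_rangeRestrict, Submodule.range_subtype])] at hlen
  rw [← Module.length_eq_one_iff]
  have h1 := Order.one_le_iff_pos.2 (Module.length_pos (R := DownUpAlgebra α β γ)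
    (M := LinearMap.ker f))
  have h2 := Order.one_le_iff_pos.2 (Module.length_pos (R := DownUpAlgebra α β γ)
    (M := LinearMap.range f))
  refine le_antisymm ?_ h2
  have h3 := (add_le_add_left h1 _).trans hlen
  rw [← one_add_one_eq_two] at h3
  exact (ENat.add_le_add_iff_left ENat.one_ne_top).1 h3

theorem AtMostOneZero.ker_le_socle [IsAlgClosed K] [FiniteDimensional K M]
    (h : AtMostOneZero α β γ) (hu : IsNilpotent (act (gu α β γ) : Module.End K M)) {v : M}
    (hv : gd α β γ • v = 0) :
    v ∈ sSup {S : Submodule (DownUpAlgebra α β γ) M | IsSimpleModule (DownUpAlgebra α β γ) S} := by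
  set N := sSup {S : Submodule (DownUpAlgebra α β γ) M | IsSimpleModule (DownUpAlgebra α β γ) S}
  obtain ⟨k, hk⟩ := id hu
  have hss : (weightEnd α β γ M).IsSemisimple := by
    refine Module.End.isSemisimple_of_squarefree_aeval_eq_zero (h.squarefree_prod k) ?_
    ext w
    rw [← gd_pow_smul_gu_pow_smul, mul_smul, smul_pow_eq_zero hk, smul_zero]
    rfl
  have hle : (⊤ : Submodule K (LinearMap.ker (act (gd α β γ) : Module.End K M))) ≤
      (N.restrictScalars K).comap (LinearMap.ker (act (gd α β γ) : Module.End K M)).subtype := by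
    rw [← hss.iSup_eigenspace_eq_top, iSup_le_iff]
    intro lam w hw
    rw [Module.End.mem_eigenspace_iff] at hw
    change (w : M) ∈ N
    by_cases hw0 : (w : M) = 0
    · rw [hw0]
      exact N.zero_mem
    · obtain ⟨S, hS, hwS⟩ := exists_simple_mem hw0 w.2 (congrArg Subtype.val hw) hu
        (h.length_le_two lam)
      exact le_sSup (a := S) hS hwS
  exact hle (x := ⟨v, hv⟩) trivial

/-- If `d v` lies in a submodule `N` and `v` is a weight vector modulo `N` of highest weight `λ`,
where `λ` does not occur just above a lowest weight, then `d v` lies in `d N`. -/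
theorem exists_gd_smul_eq (hβ : β ≠ 0) (hd : IsNilpotent (act (gd α β γ) : Module.End K M))
    {N : Submodule (DownUpAlgebra α β γ) M} {lam : K} (hback : ∀ j, backSeq α β γ lam (j + 2) ≠ 0)
    {v : M} (hv : gd α β γ • v ∈ N) (hlam : (gd α β γ * gu α β γ) • v - lam • v ∈ N) :
    ∃ y ∈ N, gd α β γ • y = gd α β γ • v := by
  set x := gd α β γ • v with hx
  -- L = dN is taken only as a K-subspace, but moving d to the left shows that it is stable under
  -- every `lowerSeq` and every u^k d^k.
  let L : Submodule K M := (N.restrictScalars K).map (act (gd α β γ))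
  have hL : ∀ y ∈ N, gd α β γ • y ∈ L := fun y hy => ⟨y, hy, rfl⟩
  have hlow : ∀ k, ∀ y ∈ L, lowerSeq α β γ k • y ∈ L := by
    rintro k _ ⟨y, hy, rfl⟩
    rw [Algebra.lsmul_apply, smul_smul, lowerSeq_mul_gd α β γ hβ, mul_smul]
    exact hL _ (N.smul_mem _ hy)
  have hstable : ∀ k, ∀ y ∈ L, (gu α β γ ^ k * gd α β γ ^ k) • y ∈ L := by
    intro k
    induction k with
    | zero => simp
    | succ k ih =>
      intro y hy
      rw [gu_pow_mul_gd_pow_succ α β γ hβ, mul_smul]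
      exact ih _ (hlow _ y hy)
  -- Modulo dN, the element `lowerSeq` k acts on x = dv as λ_{-k}: for k = 0 because du v ≡ λv
  -- modulo N, for k = 1 because (du)x = d(ux) with ux in N.
  have hcong : ∀ k, lowerSeq α β γ k • x - backSeq α β γ lam k • x ∈ L := by
    intro k
    induction k using Nat.twoStepInduction with
    | zero =>
      rw [hx, smul_smul, lowerSeq_mul_gd α β γ hβ, mul_smul, backSeq, smul_comm lam, ← smul_sub]
      exact hL _ hlam
    | one =>
      rw [lowerSeq, backSeq, zero_smul, sub_zero, mul_smul]
      exact hL _ (N.smul_mem _ hv)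
    | more n h1 h2 =>
      have h3 := L.smul_mem β⁻¹ (L.sub_mem h1 (L.smul_mem α h2))
      convert h3 using 1
      simp only [lowerSeq, backSeq, sub_smul, smul_assoc, one_smul]
      generalize lowerSeq α β γ n • x = a
      generalize lowerSeq α β γ (n + 1) • x = b
      clear_value x
      module
  have hprod : ∀ k, (gu α β γ ^ k * gd α β γ ^ k) • x -
      (∏ i ∈ Finset.range k, backSeq α β γ lam (i + 2)) • x ∈ L := by
    intro k
    induction k with
    | zero => simp
    | succ k ih =>
      have h1 := hstable k _ (hcong (k + 2))
      have h2 := L.add_mem h1 (L.smul_mem (backSeq α β γ lam (k + 2)) ih)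
      convert h2 using 1
      rw [gu_pow_mul_gd_pow_succ α β γ hβ, mul_smul, smul_sub, smul_sub, smul_comm (_ * _)
        (backSeq α β γ lam (k + 2)) x, Finset.prod_range_succ, mul_comm (∏ i ∈ _, _),
        mul_smul (backSeq _ _ _ _ _), sub_add_sub_cancel]
  -- Nilpotency of d kills u^k d^k x, so a nonzero multiple of x lies in dN.
  obtain ⟨k, hk⟩ := hd
  have h1 := hprod k
  rw [mul_smul, smul_pow_eq_zero hk, smul_zero, zero_sub, L.neg_mem_iff,
    L.smul_mem_iff (Finset.prod_ne_zero_iff.2 fun i _ => hback i)] at h1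
  exact h1

theorem AtMostOneZero.isSemisimpleModule [IsAlgClosed K] [CharZero K] [FiniteDimensional K M]
    {η : K} (h : AtMostOneZero α β γ) (hαη : α = 1 + η) (hβη : β = -η) (hγ : γ ≠ 0)
    (hη0 : η ≠ 0) (hη1 : η ≠ 1) : IsSemisimpleModule (DownUpAlgebra α β γ) M := by
  have hβ : β ≠ 0 := by rw [hβη]; exact neg_ne_zero.2 hη0
  obtain ⟨hd, hu⟩ := isNilpotent_generators (M := M) hαη hβη hγ hη0 hη1
  rw [← sSup_simples_eq_top_iff_isSemisimpleModule]
  have hker := fun v : M => h.ker_le_socle hu (v := v)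
  set N := sSup {S : Submodule (DownUpAlgebra α β γ) M | IsSimpleModule (DownUpAlgebra α β γ) S}
  by_contra hN
  have : Nontrivial (M ⧸ N) := Submodule.Quotient.nontrivial_iff.2 hN
  have : FiniteDimensional K (M ⧸ N) :=
    Module.Finite.of_surjective (N.mkQ.restrictScalars K) N.mkQ_surjective
  obtain ⟨hd', hu'⟩ := isNilpotent_generators (M := M ⧸ N) hαη hβη hγ hη0 hη1
  obtain ⟨z, lam, hz0, hz, hlam⟩ := exists_highest_weight_vector hd'
  obtain ⟨i, hi, hi0⟩ := exists_vermaSeq_eq_zero hz0 hz hlam hu'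
  obtain ⟨v, rfl⟩ := N.mkQ_surjective z
  -- The weight is that of a finite-dimensional quotient, so its sequence has a zero, and by
  -- `AtMostOneZero` none can occur among λ_{-2}, λ_{-3}, ….
  obtain ⟨y, hy, hyv⟩ := exists_gd_smul_eq (lam := lam) (v := v) hβ hd
    (h.backSeq_ne_zero hβ hi hi0)
    (by rwa [← map_smul, Submodule.mkQ_apply, Submodule.Quotient.mk_eq_zero] at hz)
    ((Submodule.Quotient.eq _).1 hlam)
  refine hz0 ((Submodule.Quotient.mk_eq_zero _).2 ?_)
  have h1 := hker (v - y) (by rw [smul_sub, hyv, sub_self])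
  simpa using N.add_mem h1 hy

end FiniteDimensional

end DownUp

theorem theorem5p5 {K : Type u} [Field K] [IsAlgClosed K] [CharZero K]
    (α β γ η : K) (hαβ : α + β = 1) (hγ : γ ≠ 0) (hη : η = -β) (hη0 : η ≠ 0) (hη1 : η ≠ 1) :
    List.TFAE [
      -- every finite-dimensional module is semisimple
      ∀ (M : Type u) [AddCommGroup M] [Module K M] [Module (DownUpAlgebra α β γ) M]
        [IsScalarTower K (DownUpAlgebra α β γ) M] [FiniteDimensional K M],
        IsSemisimpleModule (DownUpAlgebra α β γ) M,
      -- every Verma module has composition length at most 2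
      ∀ lam : K, Module.length (DownUpAlgebra α β γ) (DownUpVerma α β γ lam) ≤ 2,
      -- `η` lies in none of the sets `X_{m,n}` with `m ≠ n`
      ∀ m n : ℕ, 1 ≤ m → 1 ≤ n → m ≠ n → η ∉ DownUp.X K m n] := by
  obtain rfl : β = -η := by rw [hη, neg_neg]
  obtain rfl : α = 1 + η := by linear_combination hαβ
  rw [← DownUp.atMostOneZero_iff hγ hη0 hη1]
  tfae_have 1 → 3 := DownUp.atMostOneZero_of_isSemisimpleModule
  tfae_have 2 → 3 := DownUp.atMostOneZero_of_length_le_two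
  tfae_have 3 → 2 := fun h => h.length_le_two
  tfae_have 3 → 1 := fun h M _ _ _ _ _ => h.isSemisimpleModule rfl rfl hγ hη0 hη1
  tfae_finish
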